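/- Theorem. For an integer $r\ge 3$ let $G_r$ be the simple graph obtained from the cycle $C_r$ by attaching along each edge, in cyclically consistent orientation, a diamond graph (two triangles sharing an edge). Explicitly, $G_r$ has the $3r$ vertices $a_i,b_i,c_i$ ($i\in\mathbb Z/r\mathbb Z$) and the edges $a_ia_{i+1}$, $a_ib_i$, $a_{i+1}b_i$, $a_ic_i$, $b_ic_i$ ($i\in\mathbb Z/r\mathbb Z$). Let $M$ be the adjacency matrix of $G_r$, let $K$ be any orbit of the automorphism group of $G_r$ on the vertices, and let $D_K$ be the diagonal $0$–$1$ matrix whose diagonal entry at a vertex $x$ is $1$ exactly when $x\in K$. Let $Q\in\mathbb R$ be transcendental (over $\mathbb Q$) and put $M^K=M+Q\cdot D_K$. Then $M^K$ exhibits pretty good fractional revival with respect to $K$; that is, the closure of the set $\{\exp(itM^K)_{K\times K} : t\ge 0\}$ of $K\times K$ submatrices contains a unitary $K\times K$ matrix that is not a scalar multiple of the identity. -/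

import Mathlib

/-- The vertices of the cycle with added diamonds, indexed by residues modulo `r`. -/
inductive DiamondVertex (r : ℕ) : Type
  /-- the `i`-th vertex of the central cycle -/
  | core (i : ZMod r)
  /-- the new vertex joined to both ends of the cycle edge from `core i` to `core (i + 1)` -/
  | apex (i : ZMod r)
  /-- the new vertex joined to `core i` and to `apex i` -/
  | tip (i : ZMod r)
  deriving DecidableEq

/-- The vertex set consists of three copies of the residues modulo `r`. -/
def DiamondVertex.equivSum (r : ℕ) : (ZMod r ⊕ ZMod r ⊕ ZMod r) ≃ DiamondVertex r where
  toFun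
    | .inl i => .core i
    | .inr (.inl i) => .apex i
    | .inr (.inr i) => .tip i
  invFun
    | .core i => .inl i
    | .apex i => .inr (.inl i)
    | .tip i => .inr (.inr i)
  left_inv := by rintro (i | i | i) <;> rfl
  right_inv := by rintro (i | i | i) <;> rfl

instance DiamondVertex.instFintype (r : ℕ) [NeZero r] : Fintype (DiamondVertex r) :=
  Fintype.ofEquiv _ (DiamondVertex.equivSum r)

/-- The edges, each listed in one direction. For every `i` the cycle edge from `core i` to
`core (i + 1)` lies in the diamond formed by the triangles `core i, core (i + 1), apex i` and
`core i, apex i, tip i`, which share the edge from `core i` to `apex i`. -/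
inductive DiamondEdge (r : ℕ) : DiamondVertex r → DiamondVertex r → Prop
  | cycle (i : ZMod r) : DiamondEdge r (.core i) (.core (i + 1))
  | core_apex (i : ZMod r) : DiamondEdge r (.core i) (.apex i)
  | succ_apex (i : ZMod r) : DiamondEdge r (.core (i + 1)) (.apex i)
  | core_tip (i : ZMod r) : DiamondEdge r (.core i) (.tip i)
  | apex_tip (i : ZMod r) : DiamondEdge r (.apex i) (.tip i)

/-- The graph `G_r`: the cycle of length `r` with a diamond attached along each edge. -/
def cycleDiamondGraph (r : ℕ) : SimpleGraph (DiamondVertex r) :=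
  SimpleGraph.fromRel (DiamondEdge r)

/-- The diagonal matrix `D_K` with entries `1` in `K` and `0` outside of `K`. -/
def diagIndicator {X : Type*} [DecidableEq X] (K : Finset X) : Matrix X X ℝ :=
  Matrix.diagonal fun x => if x ∈ K then 1 else 0

/-- The `K × K` submatrix of `exp (i t M)`. -/
noncomputable def walkBlock {X : Type*} [Fintype X] [DecidableEq X]
    (M : Matrix X X ℝ) (K : Finset X) (t : ℝ) : Matrix K K ℂ :=
  (NormedSpace.exp ((Complex.I * (t : ℂ)) • M.map (fun a : ℝ => (a : ℂ)))).submatrix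
    (fun k : K => (k : X)) (fun k : K => (k : X))

/-- Pretty good fractional revival of a real symmetric matrix `M` with respect to `K`: the closure
of the family `exp (i t M)_{K × K}`, `t ≥ 0`, contains a unitary matrix that is not a scalar
multiple of the identity. -/
def ExhibitsPGFR {X : Type*} [Fintype X] [DecidableEq X]
    (M : Matrix X X ℝ) (K : Finset X) : Prop :=
  ¬ (closure {A : Matrix K K ℂ | ∃ t : ℝ, 0 ≤ t ∧ A = walkBlock M K t} ∩
      {U : Matrix K K ℂ | U ∈ Matrix.unitaryGroup K ℂ} ⊆
    {A : Matrix K K ℂ | ∃ ρ : ℂ, A = ρ • (1 : Matrix K K ℂ)})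

/-!
Write `B = M + Q D_K` and let `P` be the rotation of `G_r` by one step, `S = P + P⁻¹`. The eigenvalues
of `S` are algebraic numbers `s ∈ [-2, 2]`. The limit point exhibited is the `K × K` block of
`exp (i (S + Q))`, which is unitary because `K` is invariant under rotation, and not scalar because
the block of `S` is not scalar and its eigenvalues differ by at most `4 < 2π`.

On the part of the space where `S = s`, the matrix `B` acts by a `3 × 3` matrix whose characteristic
polynomial depends only on `s` and has the form `φ_s - Q ψ_s` with
`φ_s = X³ - s X² - (4 + s) X - 2` and `ψ_s` monic of degree two. This polynomial is linear in `s`,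
so each eigenvalue `l` of `B` determines `s`, and `S` is scalar on each eigenspace of `B`
(`smul_rotationSum_mulVec`, `exists_rotationSum_eigenvalue_and_cubic`). For `s ∈ [-2, 2]` the
polynomials `φ_s`, `ψ_s` are coprime, so `φ_s - Q ψ_s` is irreducible over the field generated by `Q`
over the real algebraic numbers (`irreducible_map_sub_C_mul_map`). Hence three times the normalized
trace to that field is an additive map `f` with `f l = s + Q` for every eigenvalue `l` of `B`
belonging to `s` (`exists_addHom_eq_add_of_cubic`).

Every character `x ↦ exp (i f(x))` of the discrete group `ℝ` is, on finite sets, a limit of the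
characters `x ↦ exp (i t x)` with `t ≥ 0` (`exists_exp_mul_near_exp_addHom`). On the spectrum of
`B` this says that `exp (i t B)` comes arbitrarily close to `exp (i (S + Q))`
(`exhibitsPGFR_of_eigenvectors`).
-/

/-! ### Kronecker's approximation theorem -/

open Filter Topology in
/-- The mean value of `t ↦ exp (i t a)` over `[0, ∞)` detects whether the frequency `a` vanishes. -/
theorem tendsto_mean_exp (a : ℝ) :
    Tendsto (fun R : ℝ => (R : ℂ)⁻¹ * ∫ t in (0 : ℝ)..R, Complex.exp (Complex.I * t * a))
      atTop (𝓝 (if a = 0 then 1 else 0)) := by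
  split_ifs with ha
  · refine tendsto_const_nhds.congr' ?_
    filter_upwards [eventually_gt_atTop 0] with R hR
    have : (R : ℂ) ≠ 0 := by exact_mod_cast hR.ne'
    simp [ha, this]
  · have hc : Complex.I * (a : ℂ) ≠ 0 := by simp [ha]
    have h1 : ∀ R : ℝ, ∫ t in (0 : ℝ)..R, Complex.exp (Complex.I * t * a) =
        (Complex.exp (Complex.I * a * R) - 1) / (Complex.I * a) := by
      intro R
      have := integral_exp_mul_complex (a := 0) (b := R) hc
      simp only [Complex.ofReal_zero, mul_zero, Complex.exp_zero] at this
      rw [← this]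
      congr 1 with t
      ring_nf
    refine squeeze_zero_norm' (a := fun R : ℝ => R⁻¹ * (2 / |a|)) ?_ ?_
    · filter_upwards [eventually_gt_atTop 0] with R hR
      have h2 : ‖Complex.exp (Complex.I * a * R) - 1‖ ≤ 2 := by
        refine (norm_sub_le _ _).trans ?_
        have : Complex.I * a * R = ((a * R : ℝ) : ℂ) * Complex.I := by push_cast; ring
        rw [this, Complex.norm_exp_ofReal_mul_I]
        norm_num
      rw [h1, norm_mul, norm_div, norm_inv, norm_mul, Complex.norm_I, one_mul,
        Complex.norm_real, Complex.norm_real, Real.norm_of_nonneg hR.le, Real.norm_eq_abs]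
      gcongr
    · simpa using tendsto_inv_atTop_zero.mul_const (2 / |a|)

open Filter Topology in
/-- The coefficients of a trigonometric polynomial are bounded by its supremum on `[0, ∞)`. -/
theorem norm_coeff_le_of_norm_trigPoly_le (M : Finset ℝ) (c : ℝ → ℂ) (C : ℝ)
    (hC : ∀ t : ℝ, 0 ≤ t → ‖∑ μ ∈ M, c μ * Complex.exp (Complex.I * t * μ)‖ ≤ C)
    {ν : ℝ} (hν : ν ∈ M) : ‖c ν‖ ≤ C := by
  have hint : ∀ R : ℝ, ∀ μ : ℝ, IntervalIntegrable
      (fun t : ℝ => c μ * Complex.exp (Complex.I * t * ((μ - ν : ℝ) : ℂ)))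
      MeasureTheory.volume 0 R := fun R μ =>
    Continuous.intervalIntegrable (by fun_prop) _ _
  have hlim : Tendsto (fun R : ℝ => (R : ℂ)⁻¹ * ∫ t in (0 : ℝ)..R,
      ∑ μ ∈ M, c μ * Complex.exp (Complex.I * t * ((μ - ν : ℝ) : ℂ))) atTop (𝓝 (c ν)) := by
    have h := tendsto_finsetSum M fun μ _ => (tendsto_mean_exp (μ - ν)).const_mul (c μ)
    have e : ∑ μ ∈ M, c μ * (if μ - ν = 0 then (1 : ℂ) else 0) = c ν := by
      simp [sub_eq_zero, hν]
    rw [e] at h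
    refine h.congr fun R => ?_
    rw [intervalIntegral.integral_finsetSum fun μ _ => hint R μ, Finset.mul_sum]
    refine Finset.sum_congr rfl fun μ _ => ?_
    rw [intervalIntegral.integral_const_mul]
    ring
  refine le_of_tendsto hlim.norm ?_
  filter_upwards [eventually_gt_atTop 0] with R hR
  have hb : ‖∫ t in (0 : ℝ)..R,
      ∑ μ ∈ M, c μ * Complex.exp (Complex.I * t * ((μ - ν : ℝ) : ℂ))‖ ≤ C * |R - 0| := by
    refine intervalIntegral.norm_integral_le_of_norm_le_const fun t ht => ?_
    rw [Set.uIoc_of_le hR.le] at ht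
    have e : ∑ μ ∈ M, c μ * Complex.exp (Complex.I * t * ((μ - ν : ℝ) : ℂ)) =
        Complex.exp (((-(t * ν) : ℝ) : ℂ) * Complex.I) *
          ∑ μ ∈ M, c μ * Complex.exp (Complex.I * t * μ) := by
      rw [Finset.mul_sum]
      refine Finset.sum_congr rfl fun μ _ => ?_
      rw [mul_left_comm, ← Complex.exp_add]
      congr 2
      push_cast
      ring
    rw [e, norm_mul, Complex.norm_exp_ofReal_mul_I, one_mul]
    exact hC t ht.1.le
  rw [norm_mul, norm_inv, Complex.norm_real, Real.norm_of_nonneg hR.le]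
  rw [sub_zero, abs_of_pos hR] at hb
  rw [inv_mul_le_iff₀ hR]
  linarith

/-- The number of multi-indices of total degree `p` grows polynomially in `p`. -/
theorem card_piAntidiag_le {ι : Type*} [DecidableEq ι] (T : Finset ι) (p : ℕ) :
    (T.piAntidiag p).card ≤ (p + 1) ^ T.card := by
  have := Finset.card_le_card_of_injOn (s := T.piAntidiag p)
    (t := Fintype.piFinset fun _ : T => Finset.range (p + 1)) (fun k i => k i) ?_ ?_
  · simpa using this
  · intro k hk
    have hk' := Finset.mem_piAntidiag.1 hk
    simp only [Finset.coe_range, Set.mem_pi, Set.mem_Iio, Set.mem_univ, Fintype.coe_piFinset,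
      forall_const]
    intro i
    have := Finset.single_le_sum (f := k) (fun _ _ => Nat.zero_le _) i.2
    rw [hk'.1] at this
    omega
  · intro k hk l hl h
    have hk' := Finset.mem_piAntidiag.1 hk
    have hl' := Finset.mem_piAntidiag.1 hl
    funext i
    by_cases hi : i ∈ T
    · exact congrFun h ⟨i, hi⟩
    · have h1 := mt (hk'.2 i) hi
      have h2 := mt (hl'.2 i) hi
      simp only [ne_eq, not_not] at h1 h2
      rw [h1, h2]

/-- Expand the `p`-th power of `∑ x ∈ T, exp (i (t x - f x))`. Terms of equal frequency `μ` carry the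
same phase `exp (-i f μ)` because `f` is additive, so they cannot cancel: the coefficients have
absolute values summing to `|T| ^ p`. There are only polynomially many frequencies, and each
coefficient is a mean value, bounded by `C ^ p`. -/
theorem pow_card_le_of_norm_sum_exp_le (f : ℝ →+ ℝ) (T : Finset ℝ) (C : ℝ)
    (hC : ∀ t : ℝ, 0 ≤ t → ‖∑ x ∈ T, Complex.exp (Complex.I * (t * x - f x))‖ ≤ C) (p : ℕ) :
    (T.card : ℝ) ^ p ≤ ((p : ℝ) + 1) ^ T.card * C ^ p := by
  classical
  -- `N μ` is the absolute value of the coefficient of frequency `μ`, `M` the set of frequencies.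
  set N : ℝ → ℝ := fun μ =>
    ∑ k ∈ T.piAntidiag p with ∑ x ∈ T, (k x : ℝ) * x = μ, (Nat.multinomial T k : ℝ) with hN
  set M : Finset ℝ := (T.piAntidiag p).image fun k => ∑ x ∈ T, (k x : ℝ) * x with hM
  have hN0 : ∀ μ, 0 ≤ N μ := fun μ => Finset.sum_nonneg fun _ _ => by positivity
  have hexp : ∀ t : ℝ, (∑ x ∈ T, Complex.exp (Complex.I * (t * x - f x))) ^ p =
      ∑ μ ∈ M, ((N μ : ℂ) * Complex.exp (-Complex.I * f μ)) * Complex.exp (Complex.I * t * μ) := by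
    intro t
    rw [Finset.sum_pow_eq_sum_piAntidiag,
      ← Finset.sum_fiberwise_of_maps_to (t := M) (g := fun k => ∑ x ∈ T, (k x : ℝ) * x)
        fun k hk => Finset.mem_image_of_mem _ hk]
    refine Finset.sum_congr rfl fun μ _ => ?_
    rw [hN]
    push_cast
    rw [Finset.sum_mul, Finset.sum_mul]
    refine Finset.sum_congr rfl fun k hk => ?_
    have hμ : ∑ x ∈ T, (k x : ℝ) * x = μ := (Finset.mem_filter.1 hk).2
    have hf : f μ = ∑ x ∈ T, (k x : ℝ) * f x := by
      rw [← hμ, map_sum]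
      refine Finset.sum_congr rfl fun x _ => ?_
      rw [← nsmul_eq_mul, map_nsmul, nsmul_eq_mul]
    rw [mul_assoc, ← Complex.exp_add]
    simp_rw [← Complex.exp_nat_mul]
    rw [← Complex.exp_sum, hf, ← hμ]
    congr 2
    push_cast
    rw [Finset.mul_sum, Finset.mul_sum, ← Finset.sum_add_distrib]
    refine Finset.sum_congr rfl fun x _ => ?_
    ring
  have hle : ∀ μ ∈ M, N μ ≤ C ^ p := by
    intro μ hμ
    have := norm_coeff_le_of_norm_trigPoly_le M
      (fun μ => (N μ : ℂ) * Complex.exp (-Complex.I * f μ)) (C ^ p) (fun t ht => by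
        rw [← hexp, norm_pow]
        exact pow_le_pow_left₀ (norm_nonneg _) (hC t ht) p) hμ
    have e : -Complex.I * (f μ : ℂ) = ((-f μ : ℝ) : ℂ) * Complex.I := by push_cast; ring
    simp only [e] at this
    rwa [norm_mul, Complex.norm_exp_ofReal_mul_I, mul_one, Complex.norm_real,
      Real.norm_of_nonneg (hN0 μ)] at this
  have hsum : (T.card : ℝ) ^ p = ∑ μ ∈ M, N μ := by
    have h := Finset.sum_pow_eq_sum_piAntidiag T (fun _ => (1 : ℝ)) p
    simp only [Finset.sum_const, nsmul_eq_mul, mul_one, one_pow, Finset.prod_const_one] at h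
    rw [h, ← Finset.sum_fiberwise_of_maps_to (t := M) (g := fun k => ∑ x ∈ T, (k x : ℝ) * x)
        fun k hk => Finset.mem_image_of_mem _ hk]
  have hC0 : 0 ≤ C := (norm_nonneg _).trans (hC 0 le_rfl)
  have hcard : (M.card : ℝ) ≤ ((p : ℝ) + 1) ^ T.card := by
    exact_mod_cast Finset.card_image_le.trans (card_piAntidiag_le T p)
  calc (T.card : ℝ) ^ p = ∑ μ ∈ M, N μ := hsum
    _ ≤ ∑ _μ ∈ M, C ^ p := Finset.sum_le_sum hle
    _ = M.card * C ^ p := by simp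
    _ ≤ _ := by gcongr

open Filter Topology in
/-- The terms of the sum can be nearly aligned: a uniform bound `C < |T|` would contradict
`|T| ^ p ≤ (p + 1) ^ |T| * C ^ p` for large `p`. -/
theorem exists_lt_norm_sum_exp (f : ℝ →+ ℝ) (T : Finset ℝ) (hT : T.Nonempty) {δ : ℝ} (hδ : 0 < δ) :
    ∃ t : ℝ, 0 ≤ t ∧ (T.card : ℝ) - δ < ‖∑ x ∈ T, Complex.exp (Complex.I * (t * x - f x))‖ := by
  by_contra! h
  have hn : (1 : ℝ) ≤ T.card := by exact_mod_cast hT.card_pos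
  set n : ℝ := (T.card : ℝ) with hndef
  set C : ℝ := max (n - δ) (1 / 2) with hCdef
  have hC0 : 0 < C := lt_of_lt_of_le (by norm_num) (le_max_right _ _)
  have hCn : C < n := max_lt (by linarith) (by linarith)
  have key := pow_card_le_of_norm_sum_exp_le f T C fun t ht => (h t ht).trans (le_max_left _ _)
  set q : ℝ := C / n with hq
  have hq0 : 0 < q := by positivity
  have hq1 : q < 1 := (div_lt_one (by linarith)).2 hCn
  have hlim := (tendsto_pow_const_mul_const_pow_of_abs_lt_one T.card
    (by rwa [abs_of_pos hq0])).comp (tendsto_add_atTop_nat 1)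
  have hge : ∀ p : ℕ, q ≤ ((p + 1 : ℕ) : ℝ) ^ T.card * q ^ (p + 1) := by
    intro p
    have h1 := key p
    have hnp : 0 < n ^ p := by positivity
    have h2 : 1 ≤ ((p : ℝ) + 1) ^ T.card * q ^ p := by
      rw [hq, div_pow, mul_div_assoc', le_div_iff₀ hnp, one_mul]
      exact h1
    push_cast
    rw [pow_succ]
    nlinarith
  have := ge_of_tendsto hlim (Eventually.of_forall hge)
  linarith

/-- **Kronecker's approximation theorem**, in the form: every character `x ↦ exp (i f(x))` of the
discrete group `ℝ` is a pointwise limit, on finite sets, of the continuous characters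
`x ↦ exp (i t x)` with `t ≥ 0`. -/
theorem exists_exp_mul_near_exp_addHom (f : ℝ →+ ℝ) (S : Finset ℝ) {ε : ℝ} (hε : 0 < ε) :
    ∃ t : ℝ, 0 ≤ t ∧ ∀ x ∈ S,
      ‖Complex.exp (Complex.I * t * x) - Complex.exp (Complex.I * f x)‖ < ε := by
  classical
  -- The frequency `0` contributes the constant term `1`, to which the other terms must align.
  set T := insert (0 : ℝ) S with hT
  set δ : ℝ := min 1 (ε ^ 2 / 8) with hδdef
  have hδ : 0 < δ := by positivity
  obtain ⟨t, ht, h⟩ := exists_lt_norm_sum_exp f T (Finset.insert_nonempty _ _) hδ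
  refine ⟨t, ht, fun x hx => ?_⟩
  rcases eq_or_ne x 0 with rfl | hx0
  · simpa using hε
  set z : ℝ → ℂ := fun x => Complex.exp (Complex.I * (t * x - f x)) with hz
  have hz1 : ∀ x, ‖z x‖ = 1 := by
    intro x
    have : Complex.I * ((t : ℂ) * x - f x) = ((t * x - f x : ℝ) : ℂ) * Complex.I := by
      push_cast; ring
    rw [hz]
    simp only [this]
    exact Complex.norm_exp_ofReal_mul_I _
  have hz0 : z 0 = 1 := by simp [hz]
  have hxT : x ∈ T := Finset.mem_insert_of_mem hx
  have h0T : (0 : ℝ) ∈ T.erase x := Finset.mem_erase.2 ⟨hx0.symm, Finset.mem_insert_self _ _⟩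
  have hsplit : ∑ y ∈ T, z y = (z x + 1) + ∑ y ∈ (T.erase x).erase 0, z y := by
    rw [← Finset.add_sum_erase T z hxT, ← Finset.add_sum_erase _ z h0T, hz0, add_assoc]
  have hrest : ‖∑ y ∈ (T.erase x).erase 0, z y‖ ≤ T.card - 2 := by
    refine (norm_sum_le _ _).trans ?_
    simp only [hz1, Finset.sum_const, nsmul_eq_mul, mul_one]
    have h1 := Finset.card_erase_add_one hxT
    have h2 := Finset.card_erase_add_one h0T
    have : ((((T.erase x).erase 0).card + 1 + 1 : ℕ) : ℝ) = T.card := by rw [h2, h1]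
    push_cast at this
    linarith
  have hbig : 2 - δ < ‖z x + 1‖ := by
    have : ‖∑ y ∈ T, z y‖ ≤ ‖z x + 1‖ + ‖∑ y ∈ (T.erase x).erase 0, z y‖ := by
      rw [hsplit]; exact norm_add_le _ _
    linarith
  have hpar := parallelogram_law_with_norm ℝ (z x) 1
  rw [hz1, norm_one] at hpar
  have hδ1 : δ ≤ 1 := min_le_left _ _
  have hδ2 : δ ≤ ε ^ 2 / 8 := min_le_right _ _
  have hfin : ‖z x - 1‖ < ε := by
    refine lt_of_pow_lt_pow_left₀ 2 hε.le ?_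
    nlinarith
  have hrw : Complex.exp (Complex.I * t * x) - Complex.exp (Complex.I * f x) =
      Complex.exp ((f x : ℂ) * Complex.I) * (z x - 1) := by
    rw [mul_sub, mul_one, hz]
    simp only
    rw [← Complex.exp_add]
    ring_nf
  rw [hrw, norm_mul, Complex.norm_exp_ofReal_mul_I, one_mul]
  exact hfin

/-! ### The trace functional for polynomials linear in a transcendental -/

open Polynomial IntermediateField algebraAdjoinAdjoin in
/-- If `φ` is monic and coprime to `ψ` of smaller degree, then `φ - Q ψ` is irreducible over `K(Q)`
for `Q` transcendental over `K`: with the roles of the two variables exchanged it has degree one in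
`Q` with coprime coefficients, and Gauss's lemma passes from `K[Q]` to `K(Q)`. -/
theorem irreducible_map_sub_C_mul_map {K E : Type*} [Field K] [Field E] [Algebra K E] {Q : E}
    (hQ : Transcendental K Q) {φ ψ : K[X]} (hφ : φ.Monic) (hψ : ψ ≠ 0)
    (hdeg : ψ.degree < φ.degree) (hcop : IsCoprime φ ψ) :
    Irreducible (φ.map (algebraMap K K⟮Q⟯) -
      C (AdjoinSimple.gen K Q) * ψ.map (algebraMap K K⟮Q⟯)) := by
  let A := Algebra.adjoin K {Q}
  let e := Polynomial.algEquivOfTranscendental K Q hQ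
  have : UniqueFactorizationMonoid A := hQ.uniqueFactorizationMonoid_adjoin
  let P : K[X][X] := φ.map C - C X * ψ.map C
  have hP : P = Bivariate.swap (C (-ψ) * X + C φ) := by
    rw [map_add, map_mul, Bivariate.swap_Y, Bivariate.swap_C, Bivariate.swap_C, Polynomial.map_neg]
    ring
  have hirr : Irreducible P := by
    rw [hP, MulEquiv.irreducible_iff]
    exact irreducible_C_mul_X_add_C (neg_ne_zero.2 hψ) (hcop.symm.neg_left).isRelPrime
  have hmon : P.Monic := by
    refine (hφ.map C).sub_of_left ?_
    refine lt_of_le_of_lt (degree_mul_le _ _) ?_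
    rw [degree_C X_ne_zero, zero_add, degree_map_eq_of_injective (C_injective),
      degree_map_eq_of_injective (C_injective)]
    exact hdeg
  have hmapirr : Irreducible (P.map (e : K[X] →+* A)) := by
    rw [← MulEquiv.irreducible_iff (mapEquiv e.toRingEquiv)] at hirr
    simpa using hirr
  have := ((hmon.map (e : K[X] →+* A)).irreducible_iff_irreducible_map_fraction_map
    (K := K⟮Q⟯)).1 hmapirr
  convert this using 1
  rw [Polynomial.map_map]
  simp only [P, Polynomial.map_sub, Polynomial.map_mul, Polynomial.map_map, map_C]
  have he : (algebraMap A K⟮Q⟯).comp ((e : K[X] →+* A).comp C) = algebraMap K K⟮Q⟯ := by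
    ext a
    refine congrArg Subtype.val (?_ : algebraMap A K⟮Q⟯ (e (C a)) = algebraMap K K⟮Q⟯ a)
    rw [← algebraMap_eq, e.commutes]
    rfl
  have hX : (algebraMap A K⟮Q⟯) ((e : K[X] →+* A) X) = AdjoinSimple.gen K Q := by
    refine Subtype.ext ((coe_algebraMap K {Q} (e X)).trans ?_)
    simp [e]
  rw [RingHom.comp_assoc, he, RingHom.comp_apply, hX]

open Polynomial IntermediateField in
/-- A single `K`-linear functional, an extension of the normalized trace of the algebraic closure of
`K(Q)` in `E` down to `K(Q)`, sends a root of any `φ - Q ψ` (with `φ`, `ψ` as in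
`irreducible_map_sub_C_mul_map`) to the arithmetic mean of all roots of this polynomial. -/
theorem exists_linearMap_eq_of_aeval_eq {K E : Type*} [Field K] [CharZero K] [Field E]
    [Algebra K E] {Q : E}
    (hQ : Transcendental K Q) :
    ∃ f : E →ₗ[K] E, ∀ φ ψ : K[X], φ.Monic → ψ ≠ 0 → ψ.degree < φ.degree → IsCoprime φ ψ →
      ∀ l : E, aeval l φ = Q * aeval l ψ →
        f l = -(φ.natDegree : E)⁻¹ * (algebraMap K E (φ.coeff (φ.natDegree - 1)) -
          Q * algebraMap K E (ψ.coeff (φ.natDegree - 1))) := by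
  let F := K⟮Q⟯
  let L := algebraicClosure F E
  obtain ⟨g, hg⟩ := LinearMap.exists_extend (p := Subalgebra.toSubmodule L.toSubalgebra)
    (Algebra.normalizedTrace F L)
  refine ⟨(Algebra.linearMap F E ∘ₗ g).restrictScalars K, fun φ ψ hφ hψ hdeg hcop l hl => ?_⟩
  set P : F[X] := φ.map (algebraMap K F) -
    C (AdjoinSimple.gen K Q) * ψ.map (algebraMap K F) with hP
  have hirr : Irreducible P := irreducible_map_sub_C_mul_map hQ hφ hψ hdeg hcop
  have hlt : (C (AdjoinSimple.gen K Q) * ψ.map (algebraMap K F)).degree <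
      (φ.map (algebraMap K F)).degree := by
    refine lt_of_le_of_lt (degree_mul_le _ _) ?_
    rw [degree_map, degree_map]
    refine lt_of_le_of_lt ?_ hdeg
    simpa using add_le_add_left degree_C_le ψ.degree
  have hmon : P.Monic := (hφ.map _).sub_of_left hlt
  have hnat : P.natDegree = φ.natDegree := by
    rw [hP, natDegree, degree_sub_eq_left_of_degree_lt hlt, degree_map, natDegree]
  have hroot : aeval l P = 0 := by
    simp [hP, hl, aeval_map_algebraMap]
  have hlL : l ∈ L := mem_algebraicClosure_iff.2 ⟨P, hmon.ne_zero, hroot⟩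
  have hrootL : aeval (⟨l, hlL⟩ : L) P = 0 := by
    refine (algebraMap L E).injective ?_
    rw [← aeval_algebraMap_apply, map_zero]
    exact hroot
  have hmin : minpoly F (⟨l, hlL⟩ : L) = P :=
    (minpoly.eq_of_irreducible_of_monic hirr hrootL hmon).symm
  have hgl : g l = Algebra.normalizedTrace F L ⟨l, hlL⟩ := by
    rw [← hg]; rfl
  have hpos : 0 < φ.natDegree := by
    rw [← hnat]
    exact hirr.natDegree_pos
  simp only [LinearMap.coe_restrictScalars, LinearMap.comp_apply, Algebra.linearMap_apply, hgl]
  rw [Algebra.normalizedTrace_minpoly, hmin, nextCoeff_of_natDegree_pos (by rwa [hnat]), hnat]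
  simp [hP]
  ring

open Polynomial in
/-- The expression assumed nonzero is the resultant of the quadratic and of the remainder
`u X + w` of the cubic modulo the quadratic. -/
theorem isCoprime_cubic_quadratic {K : Type*} [Field K] (s b c : K)
    (h : (c * (b - s) - 2) ^ 2 + b * (c + b * (b - s) - 4 - s) * (c * (b - s) - 2) -
      c * (c + b * (b - s) - 4 - s) ^ 2 ≠ 0) :
    IsCoprime (X ^ 3 - C s * X ^ 2 - C (4 + s) * X - C 2) (X ^ 2 - C b * X - C c) := by
  set u := c + b * (b - s) - 4 - s with hu
  set w := c * (b - s) - 2 with hw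
  set R := w ^ 2 + b * u * w - c * u ^ 2 with hR
  refine ⟨-C R⁻¹ * (C u * X - C w - C u * C b),
    C R⁻¹ * (C u ^ 2 + (X + C b - C s) * (C u * X - C w - C u * C b)), ?_⟩
  have h1 : C R⁻¹ * C R = (1 : K[X]) := by rw [← C_mul, inv_mul_cancel₀ h, C_1]
  rw [← h1]
  have h6 : (C 2 : K[X]) = 2 := map_ofNat C 2
  have h7 : (C 4 : K[X]) = 4 := map_ofNat C 4
  have h2 : (C R : K[X]) = C w ^ 2 + C b * C u * C w - C c * C u ^ 2 := by simp [hR]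
  have h3 : (C u : K[X]) = C c + C b * (C b - C s) - 4 - C s := by simp [hu, h7]
  have h4 : (C w : K[X]) = C c * (C b - C s) - 2 := by simp [hw, h6]
  have h5 : (C (4 + s) : K[X]) = 4 + C s := by simp [h7]
  rw [h2, h5, h6, h3, h4]
  ring

open Polynomial in
/-- The functional is three times the normalized trace, and `s + Q` is the sum of the roots of the
cubic `X³ - s X² - (4 + s) X - 2 - Q (X² - b X - c)`. -/
theorem exists_addHom_eq_add_of_cubic {Q : ℝ} (hQ : Transcendental ℚ Q) :
    ∃ f : ℝ →+ ℝ, ∀ s b c l : ℝ, IsAlgebraic ℚ s → IsAlgebraic ℚ b → IsAlgebraic ℚ c →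
      (c * (b - s) - 2) ^ 2 + b * (c + b * (b - s) - 4 - s) * (c * (b - s) - 2) -
        c * (c + b * (b - s) - 4 - s) ^ 2 ≠ 0 →
      l ^ 3 - s * l ^ 2 - (4 + s) * l - 2 = Q * (l ^ 2 - b * l - c) → f l = s + Q := by
  -- The real algebraic numbers contain all coefficients, and `Q` is still transcendental over them.
  let A := algebraicClosure ℚ ℝ
  have : Algebra.IsAlgebraic ℚ A := algebraicClosure.isAlgebraic ℚ ℝ
  have hQA : Transcendental A Q := hQ.extendScalars A
  obtain ⟨f, hf⟩ := exists_linearMap_eq_of_aeval_eq hQA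
  refine ⟨(3 : ℝ) • f.toAddMonoidHom, fun s b c l hs hb hc hres hl => ?_⟩
  obtain ⟨s, rfl⟩ : ∃ s' : A, (s' : ℝ) = s := ⟨⟨s, mem_algebraicClosure_iff.2 hs⟩, rfl⟩
  obtain ⟨b, rfl⟩ : ∃ b' : A, (b' : ℝ) = b := ⟨⟨b, mem_algebraicClosure_iff.2 hb⟩, rfl⟩
  obtain ⟨c, rfl⟩ : ∃ c' : A, (c' : ℝ) = c := ⟨⟨c, mem_algebraicClosure_iff.2 hc⟩, rfl⟩
  have hA2 : ((2 : A) : ℝ) = 2 := rfl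
  have hA4 : ((4 : A) : ℝ) = 4 := rfl
  have hcop := isCoprime_cubic_quadratic s b c (fun h => hres <| by
    simpa [hA2, hA4] using congrArg (algebraMap A ℝ) h)
  have hφ : (X ^ 3 - C s * X ^ 2 - C (4 + s) * X - C 2 : A[X]).natDegree = 3 := by
    compute_degree!
  have hφm : (X ^ 3 - C s * X ^ 2 - C (4 + s) * X - C 2 : A[X]).Monic := by monicity!
  have hψ : (X ^ 2 - C b * X - C c : A[X]).natDegree = 2 := by compute_degree!
  have hψm : (X ^ 2 - C b * X - C c : A[X]).Monic := by monicity!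
  have h := hf _ _ hφm hψm.ne_zero
    (degree_lt_degree (by rw [hφ, hψ]; norm_num)) hcop l
    (by simpa [hA2, hA4] using hl)
  rw [hφ] at h
  have h1 : (X ^ 3 - C s * X ^ 2 - C (4 + s) * X - C 2 : A[X]).coeff 2 = -s := by
    simp
  have h2 : (X ^ 2 - C b * X - C c : A[X]).coeff 2 = 1 := by
    simp
  rw [show 3 - 1 = 2 from rfl, h1, h2] at h
  change (3 : ℝ) * f l = _
  rw [h]
  simp
  ring

/-! ### Limits of `exp (i t B)` and fractional revival -/

theorem diagIndicator_mul_apply {X : Type*} [Fintype X] [DecidableEq X] (K : Finset X)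
    (S : Matrix X X ℝ) (x y : X) :
    (diagIndicator K * S) x y = if x ∈ K then S x y else 0 := by
  simp [diagIndicator, Matrix.diagonal_mul]

theorem mul_diagIndicator_apply {X : Type*} [Fintype X] [DecidableEq X] (K : Finset X)
    (S : Matrix X X ℝ) (x y : X) :
    (S * diagIndicator K) x y = if y ∈ K then S x y else 0 := by
  simp [diagIndicator, Matrix.mul_diagonal]

/-- The real matrix `U diag(d) Uᵀ` with complex diagonal `d`. -/
noncomputable def conjDiagonal {X : Type*} [Fintype X] [DecidableEq X] (U : Matrix X X ℝ)
    (d : X → ℂ) : Matrix X X ℂ :=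
  U.map (fun a : ℝ => (a : ℂ)) * Matrix.diagonal d * (U.transpose).map (fun a : ℝ => (a : ℂ))

section
variable {X : Type*}

theorem map_ofReal_mul [Fintype X] (A B : Matrix X X ℝ) :
    (A * B).map (fun a : ℝ => (a : ℂ)) =
      A.map (fun a : ℝ => (a : ℂ)) * B.map (fun a : ℝ => (a : ℂ)) :=
  Matrix.map_mul (f := Complex.ofRealHom)

variable [DecidableEq X]

theorem map_ofReal_one : (1 : Matrix X X ℝ).map (fun a : ℝ => (a : ℂ)) = 1 :=
  Matrix.map_one Complex.ofRealHom (map_zero _) (map_one _)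

variable [Fintype X]

theorem conjDiagonal_apply (U : Matrix X X ℝ) (d : X → ℂ) (x y : X) :
    conjDiagonal U d x y = ∑ k, (U x k : ℂ) * d k * (U y k : ℂ) := by
  simp [conjDiagonal, Matrix.mul_apply, Matrix.diagonal_apply]

theorem conjDiagonal_mul {U : Matrix X X ℝ} (hU : U.transpose * U = 1) (d e : X → ℂ) :
    conjDiagonal U d * conjDiagonal U e = conjDiagonal U (fun k => d k * e k) := by
  have h : (U.transpose).map (fun a : ℝ => (a : ℂ)) * U.map (fun a : ℝ => (a : ℂ)) = 1 := by
    rw [← map_ofReal_mul, hU, map_ofReal_one]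
  simp only [conjDiagonal]
  rw [← Matrix.diagonal_mul_diagonal]
  simp only [Matrix.mul_assoc]
  rw [← Matrix.mul_assoc _ (U.map _), h, Matrix.one_mul]

theorem conjDiagonal_one {U : Matrix X X ℝ} (hU : U * U.transpose = 1) :
    conjDiagonal U (fun _ => 1) = 1 := by
  simp only [conjDiagonal]
  rw [Matrix.diagonal_one, Matrix.mul_one, ← map_ofReal_mul, hU, map_ofReal_one]

theorem conjTranspose_conjDiagonal (U : Matrix X X ℝ) (d : X → ℂ) :
    (conjDiagonal U d).conjTranspose = conjDiagonal U (fun k => star (d k)) := by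
  ext x y
  simp only [Matrix.conjTranspose_apply, conjDiagonal_apply, star_sum]
  refine Finset.sum_congr rfl fun k _ => ?_
  simp only [star_mul', Complex.star_def, Complex.conj_ofReal]
  ring

theorem exp_smul_map_ofReal_eq_conjDiagonal {U : Matrix X X ℝ} (hU : U * U.transpose = 1)
    {A : Matrix X X ℝ} {d : X → ℝ} (hA : A = U * Matrix.diagonal d * U.transpose) (c : ℂ) :
    NormedSpace.exp (c • A.map (fun a : ℝ => (a : ℂ))) =
      conjDiagonal U (fun k => Complex.exp (c * d k)) := by
  have hU' : U.transpose * U = 1 := mul_eq_one_comm.1 hU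
  have h1 : U.map (fun a : ℝ => (a : ℂ)) * (U.transpose).map (fun a : ℝ => (a : ℂ)) = 1 := by
    rw [← map_ofReal_mul, hU, map_ofReal_one]
  have h2 : (U.transpose).map (fun a : ℝ => (a : ℂ)) * U.map (fun a : ℝ => (a : ℂ)) = 1 := by
    rw [← map_ofReal_mul, hU', map_ofReal_one]
  have hinv : (U.map (fun a : ℝ => (a : ℂ)))⁻¹ = (U.transpose).map (fun a : ℝ => (a : ℂ)) :=
    Matrix.inv_eq_right_inv h1
  have hunit : IsUnit (U.map (fun a : ℝ => (a : ℂ))) := ⟨⟨_, _, h1, h2⟩, rfl⟩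
  have hA' : c • A.map (fun a : ℝ => (a : ℂ)) = U.map (fun a : ℝ => (a : ℂ)) *
      Matrix.diagonal (fun k => c * (d k : ℂ)) * (U.map (fun a : ℝ => (a : ℂ)))⁻¹ := by
    rw [hinv, hA, map_ofReal_mul, map_ofReal_mul, Matrix.diagonal_map (by simp)]
    rw [← Matrix.smul_mul, ← Matrix.mul_smul, ← Matrix.diagonal_smul]
    rfl
  rw [hA', Matrix.exp_conj _ _ hunit, Matrix.exp_diagonal, hinv, conjDiagonal]
  congr 3
  ext k
  rw [Pi.coe_exp, Complex.exp_eq_exp_ℂ]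

/-- If every eigenvector of a symmetric matrix `B` for an eigenvalue `l` is an eigenvector of `S` for
`f l`, then an orthonormal eigenbasis of `B` diagonalizes `S` as well. The last clause records that
the diagonal entries `l k` are eigenvalues of `B`. -/
theorem exists_orthogonal_diagonalization {B S : Matrix X X ℝ} (hB : B.IsHermitian) (f : ℝ → ℝ)
    (hS : ∀ (l : ℝ) (v : X → ℝ), v ≠ 0 → B.mulVec v = l • v → S.mulVec v = f l • v) :
    ∃ (U : Matrix X X ℝ) (l : X → ℝ), U * U.transpose = 1 ∧
      B = U * Matrix.diagonal l * U.transpose ∧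
      S = U * Matrix.diagonal (fun k => f (l k)) * U.transpose ∧
      ∀ k, ∃ v : X → ℝ, v ≠ 0 ∧ B.mulVec v = l k • v := by
  set U : Matrix X X ℝ := ↑(hB.eigenvectorUnitary) with hUdef
  have hUU : U * U.transpose = 1 := by
    have := Unitary.mul_star_self_of_mem hB.eigenvectorUnitary.2
    rwa [Matrix.star_eq_conjTranspose, Matrix.conjTranspose_eq_transpose_of_trivial] at this
  have hcol : ∀ k, (fun x => U x k) = (hB.eigenvectorBasis k : X → ℝ) := fun k => by
    ext x
    simp [hUdef, Matrix.IsHermitian.eigenvectorUnitary_apply]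
  have hv : ∀ k, B.mulVec (fun x => U x k) = hB.eigenvalues k • (fun x => U x k) := by
    intro k
    rw [hcol]
    exact hB.mulVec_eigenvectorBasis k
  have hne : ∀ k, (fun x => U x k) ≠ 0 := by
    intro k h
    have h1 : (U.transpose * U) k k = 1 := by rw [mul_eq_one_comm.1 hUU, Matrix.one_apply_eq]
    rw [Matrix.mul_apply] at h1
    simp only [Matrix.transpose_apply, fun x => congrFun h x, Pi.zero_apply, mul_zero,
      Finset.sum_const_zero, zero_ne_one] at h1
  have hdiag : ∀ (A : Matrix X X ℝ) (d : X → ℝ),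
      (∀ k, A.mulVec (fun x => U x k) = d k • fun x => U x k) →
        A = U * Matrix.diagonal d * U.transpose := by
    intro A d h
    have : A * U = U * Matrix.diagonal d := by
      ext x k
      rw [Matrix.mul_diagonal, mul_comm]
      exact congrFun (h k) x
    rw [← this, Matrix.mul_assoc, hUU, Matrix.mul_one]
  exact ⟨U, hB.eigenvalues, hUU, hdiag _ _ hv, hdiag _ _ fun k => hS _ _ (hne k) (hv k),
    fun k => ⟨_, hne k, hv k⟩⟩

open Matrix in
/-- Suppose that `S` acts as `f l` on each eigenspace of `B`, where `f` is additive. Kronecker's theorem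
makes `exp (i S)` a limit of matrices `exp (i t B)`, and its `K × K` block is unitary when `S`
commutes with `D_K`. If the values of `f` on the spectrum of `B` lie within less than `2π` of each
other, this block is scalar only if the block of `S` is. -/
theorem exhibitsPGFR_of_eigenvectors {B S : Matrix X X ℝ} {K : Finset X} (hB : B.IsHermitian)
    (f : ℝ →+ ℝ)
    (hS : ∀ (l : ℝ) (v : X → ℝ), v ≠ 0 → B.mulVec v = l • v → S.mulVec v = f l • v)
    (hf : ∀ (l l' : ℝ) (v v' : X → ℝ), v ≠ 0 → v' ≠ 0 → B.mulVec v = l • v →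
      B.mulVec v' = l' • v' → |f l - f l'| < 2 * Real.pi)
    (hSK : Commute S (diagIndicator K)) {x y : X} (hx : x ∈ K) (hxy : x ≠ y) (hSxy : S x y ≠ 0) :
    ExhibitsPGFR B K := by
  obtain ⟨U, l, hU, hBU, hSU, hl⟩ := exists_orthogonal_diagonalization hB f hS
  have hU' : U.transpose * U = 1 := mul_eq_one_comm.1 hU
  set d : X → ℂ := fun k => Complex.exp (Complex.I * (f (l k) : ℂ)) with hd
  set W : Matrix X X ℂ := conjDiagonal U d with hW
  have hd1 : ∀ k, d k * star (d k) = 1 := by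
    intro k
    have e : d k = Complex.exp ((f (l k) : ℂ) * Complex.I) := by rw [hd]; ring_nf
    rw [Complex.star_def, Complex.mul_conj, Complex.normSq_eq_norm_sq, e,
      Complex.norm_exp_ofReal_mul_I]
    simp
  have hWexp : W = NormedSpace.exp (Complex.I • S.map (fun a : ℝ => (a : ℂ))) :=
    (exp_smul_map_ofReal_eq_conjDiagonal hU hSU Complex.I).symm
  have hWcomm : Commute W ((diagIndicator K).map (fun a : ℝ => (a : ℂ))) := by
    rw [hWexp]
    refine Commute.exp_left (Commute.smul_left ?_ _)
    rw [Commute, SemiconjBy, ← map_ofReal_mul, hSK.eq, map_ofReal_mul]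
  have hW0 : ∀ a b, a ∈ K → b ∉ K → W a b = 0 := by
    intro a b ha hb
    have := congrFun (congrFun hWcomm.eq a) b
    simpa [diagIndicator, Matrix.diagonal_map, Matrix.mul_diagonal, Matrix.diagonal_mul, ha, hb,
      eq_comm] using this
  have hWU : W * W.conjTranspose = 1 := by
    rw [hW, conjTranspose_conjDiagonal, conjDiagonal_mul hU']
    simp only [hd1]
    exact conjDiagonal_one hU
  have hsumK : ∀ (a : X) (g : X → ℂ), a ∈ K → ∑ b : K, W a b * g b = ∑ b, W a b * g b := by
    intro a g ha
    rw [Finset.sum_coe_sort K (fun b => W a b * g b)]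
    refine Finset.sum_subset (Finset.subset_univ _) fun b _ hb => ?_
    rw [hW0 a b ha hb, zero_mul]
  intro hsub
  suffices hmem : W.submatrix (fun k : K => (k : X)) (fun k : K => (k : X)) ∈
      closure {A : Matrix K K ℂ | ∃ t : ℝ, 0 ≤ t ∧ A = walkBlock B K t} ∩
        {V : Matrix K K ℂ | V ∈ Matrix.unitaryGroup K ℂ} by
    obtain ⟨ρ, hρ⟩ := hsub hmem
    have hWx : ∀ b, W x b = if b = x then ρ else 0 := by
      intro b
      by_cases hb : b ∈ K
      · have := congrFun (congrFun hρ ⟨x, hx⟩) ⟨b, hb⟩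
        simpa [Matrix.one_apply, eq_comm] using this
      · rw [hW0 x b hx hb, if_neg]
        rintro rfl
        exact hb hx
    -- An eigenvector with nonzero entry at `x` sees the scalar `ρ` as its eigenvalue.
    have hdU : ∀ k, U x k ≠ 0 → d k = ρ := by
      intro k hk
      have h1 : (W * U.map (fun a : ℝ => (a : ℂ))) x k = (U x k : ℂ) * d k := by
        have h2 : (U.transpose).map (fun a : ℝ => (a : ℂ)) * U.map (fun a : ℝ => (a : ℂ)) = 1 := by
          rw [← map_ofReal_mul, hU', map_ofReal_one]
        rw [hW, conjDiagonal, Matrix.mul_assoc, h2, Matrix.mul_one, Matrix.mul_diagonal,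
          Matrix.map_apply]
      rw [Matrix.mul_apply] at h1
      simp only [hWx, ite_mul, zero_mul, Finset.sum_ite_eq', Finset.mem_univ, if_true,
        Matrix.map_apply] at h1
      have hk' : (U x k : ℂ) ≠ 0 := by exact_mod_cast hk
      exact mul_left_cancel₀ hk' (by rw [← h1, mul_comm])
    have hfU : ∀ k k', U x k ≠ 0 → U x k' ≠ 0 → f (l k) = f (l k') := by
      intro k k' hk hk'
      have h1 := (hdU k hk).trans (hdU k' hk').symm
      obtain ⟨n, hn⟩ := Complex.exp_eq_exp_iff_exists_int.1 h1
      have h2 : f (l k) = f (l k') + n * (2 * Real.pi) := by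
        have h3 : Complex.I * (f (l k) : ℂ) =
            Complex.I * ((f (l k') + n * (2 * Real.pi) : ℝ) : ℂ) := by
          rw [hn]; push_cast; ring
        exact_mod_cast mul_left_cancel₀ Complex.I_ne_zero h3
      obtain ⟨v, hv, hBv⟩ := hl k
      obtain ⟨v', hv', hBv'⟩ := hl k'
      have h4 := hf _ _ _ _ hv hv' hBv hBv'
      rw [h2, add_sub_cancel_left, abs_mul, abs_of_pos Real.two_pi_pos] at h4
      have h5 : |(n : ℝ)| < 1 := by nlinarith [Real.two_pi_pos]
      have h6 : n = 0 := by
        rw [← Int.abs_lt_one_iff]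
        exact_mod_cast h5
      simp [h2, h6]
    have hSe : S x y = ∑ k, U x k * f (l k) * U y k := by
      conv_lhs => rw [hSU]
      rw [Matrix.mul_apply]
      simp only [Matrix.mul_diagonal, Matrix.transpose_apply]
    by_cases hex : ∃ k, U x k ≠ 0
    · obtain ⟨k₀, hk₀⟩ := hex
      have h1 : S x y = f (l k₀) * (U * U.transpose) x y := by
        rw [hSe, Matrix.mul_apply, Finset.mul_sum]
        refine Finset.sum_congr rfl fun k _ => ?_
        by_cases hk : U x k = 0
        · simp [hk]
        · rw [hfU k k₀ hk hk₀, Matrix.transpose_apply]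
          ring
      rw [hU, Matrix.one_apply_ne hxy, mul_zero] at h1
      exact hSxy h1
    · push Not at hex
      exact hSxy (by rw [hSe]; simp [hex])
  refine ⟨?_, ?_⟩
  · have hcont : Continuous fun e : X → ℂ =>
        (conjDiagonal U e).submatrix (fun k : K => (k : X)) (fun k : K => (k : X)) := by
      refine continuous_pi fun a => continuous_pi fun b => ?_
      simp only [Matrix.submatrix_apply, conjDiagonal_apply]
      fun_prop
    have hdcl : d ∈ closure {e : X → ℂ | ∃ t : ℝ, 0 ≤ t ∧
        e = fun k => Complex.exp (Complex.I * (t : ℂ) * (l k : ℂ))} := by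
      rw [Metric.mem_closure_iff]
      intro ε hε
      obtain ⟨t, ht, h⟩ := exists_exp_mul_near_exp_addHom f (Finset.univ.image l) hε
      refine ⟨_, ⟨t, ht, rfl⟩, ?_⟩
      rw [dist_comm, dist_pi_lt_iff hε]
      intro k
      rw [dist_eq_norm]
      exact h _ (Finset.mem_image_of_mem _ (Finset.mem_univ _))
    refine map_mem_closure (f := fun e : X → ℂ =>
      (conjDiagonal U e).submatrix (fun k : K => (k : X)) (fun k : K => (k : X))) hcont hdcl ?_
    rintro _ ⟨t, ht, rfl⟩
    refine ⟨t, ht, ?_⟩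
    rw [walkBlock, exp_smul_map_ofReal_eq_conjDiagonal hU hBU]
  · rw [Set.mem_ofPred_eq, Matrix.mem_unitaryGroup_iff]
    ext a b
    have h1 := congrFun (congrFun hWU a) b
    rw [Matrix.mul_apply, ← hsumK _ _ a.2] at h1
    rw [Matrix.mul_apply]
    simp only [Matrix.star_apply, Matrix.submatrix_apply]
    rw [show (1 : Matrix K K ℂ) a b = (1 : Matrix X X ℂ) a b by
      simp only [Matrix.one_apply, Subtype.ext_iff], ← h1]
    rfl
end

/-! ### Rotations, orbits and eigenvectors of the cycle with diamonds -/

theorem isAlgebraic_of_mulVec_eq_smul {X : Type*} [Fintype X] [DecidableEq X]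
    (A : Matrix X X ℚ) {s : ℝ} {v : X → ℝ} (hv : v ≠ 0)
    (h : (A.map (algebraMap ℚ ℝ)).mulVec v = s • v) : IsAlgebraic ℚ s := by
  refine ⟨A.charpoly, A.charpoly_monic.ne_zero, ?_⟩
  rw [← Polynomial.eval_map_algebraMap, ← Matrix.charpoly_map, Matrix.eval_charpoly]
  refine Matrix.exists_mulVec_eq_zero_iff.1 ⟨v, hv, ?_⟩
  rw [Matrix.sub_mulVec, h, Matrix.scalar_apply, ← Matrix.smul_one_eq_diagonal,
    Matrix.smul_mulVec, Matrix.one_mulVec, sub_self]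

namespace DiamondVertex

variable {r : ℕ}

/-- The rotation of the vertex set by `j` steps along the cycle. -/
def shift (j : ZMod r) : DiamondVertex r → DiamondVertex r
  | core i => core (i + j)
  | apex i => apex (i + j)
  | tip i => tip (i + j)

/-- The degree of a vertex of `G_r` for `r ≥ 3` (see `degree_eq_deg`), which tells the three kinds of
vertices apart. -/
def deg : DiamondVertex r → ℕ
  | core _ => 5
  | apex _ => 3
  | tip _ => 2

@[simp] theorem deg_shift (j : ZMod r) (x : DiamondVertex r) : (shift j x).deg = x.deg := by
  cases x <;> rfl

theorem shift_shift (j k : ZMod r) (x : DiamondVertex r) :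
    shift j (shift k x) = shift (k + j) x := by
  cases x <;> simp [shift, add_assoc]

@[simp] theorem shift_zero (x : DiamondVertex r) : shift 0 x = x := by
  cases x <;> simp [shift]

theorem exists_shift_eq {x y : DiamondVertex r} (h : y.deg = x.deg) : ∃ j, shift j x = y := by
  rcases x with i | i | i <;> rcases y with k | k | k <;> simp only [deg] at h <;>
    first | omega | exact ⟨k - i, by simp [shift]⟩

theorem shift_eq_self_iff {j : ZMod r} {x : DiamondVertex r} : shift j x = x ↔ j = 0 := by
  cases x <;> simp [shift]

end DiamondVertex

open DiamondVertex

section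
variable {r : ℕ}

@[simp] theorem diamondEdge_core_core {i j : ZMod r} :
    DiamondEdge r (core i) (core j) ↔ j = i + 1 :=
  ⟨by rintro ⟨⟩; rfl, by rintro rfl; exact .cycle i⟩

@[simp] theorem diamondEdge_core_apex {i j : ZMod r} :
    DiamondEdge r (core i) (apex j) ↔ i = j ∨ i = j + 1 :=
  ⟨by rintro (_ | _) <;> simp, by
    rintro (rfl | rfl)
    exacts [.core_apex i, .succ_apex j]⟩

@[simp] theorem diamondEdge_core_tip {i j : ZMod r} :
    DiamondEdge r (core i) (tip j) ↔ i = j :=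
  ⟨by rintro ⟨⟩; rfl, by rintro rfl; exact .core_tip i⟩

@[simp] theorem diamondEdge_apex_tip {i j : ZMod r} :
    DiamondEdge r (apex i) (tip j) ↔ i = j :=
  ⟨by rintro ⟨⟩; rfl, by rintro rfl; exact .apex_tip i⟩

@[simp] theorem not_diamondEdge_apex_core {i j : ZMod r} : ¬ DiamondEdge r (apex i) (core j) := by
  rintro ⟨⟩

@[simp] theorem not_diamondEdge_apex_apex {i j : ZMod r} : ¬ DiamondEdge r (apex i) (apex j) := by
  rintro ⟨⟩

@[simp] theorem not_diamondEdge_tip {i : ZMod r} {x : DiamondVertex r} :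
    ¬ DiamondEdge r (tip i) x := by
  rintro ⟨⟩

theorem diamondEdge_shift {j : ZMod r} {x y : DiamondVertex r} :
    DiamondEdge r (shift j x) (shift j y) ↔ DiamondEdge r x y := by
  cases x <;> cases y <;> simp [shift, add_right_comm _ j 1]

/-- The rotation by `j` steps as an automorphism of `G_r`. -/
def shiftIso (j : ZMod r) : cycleDiamondGraph r ≃g cycleDiamondGraph r where
  toFun := shift j
  invFun := shift (-j)
  left_inv x := by simp [shift_shift]
  right_inv x := by simp [shift_shift]
  map_rel_iff' {x y} := by
    have hinj : shift j x = shift j y ↔ x = y :=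
      ⟨fun h => by simpa [shift_shift] using congrArg (shift (-j)) h, fun h => by rw [h]⟩
    simp only [cycleDiamondGraph, SimpleGraph.fromRel_adj, Equiv.coe_fn_mk, diamondEdge_shift,
      ne_eq, hinj]

theorem zmod_one_ne_zero (hr : 3 ≤ r) : (1 : ZMod r) ≠ 0 := by
  intro h
  have := (ZMod.natCast_eq_zero_iff 1 r).1 (by simpa using h)
  have := Nat.le_of_dvd (by norm_num) this
  omega

theorem zmod_two_ne_zero (hr : 3 ≤ r) : (2 : ZMod r) ≠ 0 := by
  intro h
  have := (ZMod.natCast_eq_zero_iff 2 r).1 (by simpa using h)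
  have := Nat.le_of_dvd (by norm_num) this
  omega

variable [NeZero r] [DecidableRel (cycleDiamondGraph r).Adj]

theorem neighborFinset_core (hr : 3 ≤ r) (i : ZMod r) :
    (cycleDiamondGraph r).neighborFinset (core i) =
      {core (i + 1), core (i - 1), apex i, apex (i - 1), tip i} := by
  have h1 := zmod_one_ne_zero hr
  ext x
  rw [SimpleGraph.mem_neighborFinset, cycleDiamondGraph, SimpleGraph.fromRel_adj]
  rcases x with j | j | j
  · simp only [ne_eq, core.injEq, diamondEdge_core_core, Finset.mem_insert, Finset.mem_singleton,
      reduceCtorEq, or_false, eq_sub_iff_add_eq]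
    constructor
    · rintro ⟨-, h | h⟩
      exacts [.inl h, .inr h.symm]
    · rintro (rfl | rfl) <;> simp [h1]
  · simp [eq_sub_iff_add_eq, eq_comm]
  · simp [eq_comm]

theorem neighborFinset_apex (i : ZMod r) :
    (cycleDiamondGraph r).neighborFinset (apex i) = {core i, core (i + 1), tip i} := by
  ext x
  rw [SimpleGraph.mem_neighborFinset, cycleDiamondGraph, SimpleGraph.fromRel_adj]
  rcases x with j | j | j <;> simp [eq_comm]

theorem neighborFinset_tip (i : ZMod r) :
    (cycleDiamondGraph r).neighborFinset (tip i) = {core i, apex i} := by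
  ext x
  rw [SimpleGraph.mem_neighborFinset, cycleDiamondGraph, SimpleGraph.fromRel_adj]
  rcases x with j | j | j <;> simp [eq_comm]

theorem sum_neighborFinset_core (hr : 3 ≤ r) {R : Type*} [AddCommMonoid R] (i : ZMod r)
    (v : DiamondVertex r → R) :
    ∑ x ∈ (cycleDiamondGraph r).neighborFinset (core i), v x =
      v (core (i + 1)) + (v (core (i - 1)) + (v (apex i) + (v (apex (i - 1)) + v (tip i)))) := by
  have h1 := zmod_one_ne_zero hr
  have h2 : i + 1 ≠ i - 1 := fun h => zmod_two_ne_zero hr (by linear_combination h)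
  have h3 : i ≠ i - 1 := fun h => h1 (by linear_combination h)
  rw [neighborFinset_core hr, Finset.sum_insert, Finset.sum_insert, Finset.sum_insert,
    Finset.sum_insert, Finset.sum_singleton] <;> simp [h2, h3]

theorem sum_neighborFinset_apex (hr : 3 ≤ r) {R : Type*} [AddCommMonoid R] (i : ZMod r)
    (v : DiamondVertex r → R) :
    ∑ x ∈ (cycleDiamondGraph r).neighborFinset (apex i), v x =
      v (core i) + (v (core (i + 1)) + v (tip i)) := by
  have h1 := zmod_one_ne_zero hr
  rw [neighborFinset_apex, Finset.sum_insert, Finset.sum_insert, Finset.sum_singleton] <;> simp [h1]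

theorem sum_neighborFinset_tip {R : Type*} [AddCommMonoid R] (i : ZMod r)
    (v : DiamondVertex r → R) :
    ∑ x ∈ (cycleDiamondGraph r).neighborFinset (tip i), v x = v (core i) + v (apex i) := by
  rw [neighborFinset_tip, Finset.sum_insert, Finset.sum_singleton]
  simp

theorem degree_eq_deg (hr : 3 ≤ r) (x : DiamondVertex r) :
    (cycleDiamondGraph r).degree x = x.deg := by
  rw [← SimpleGraph.card_neighborFinset_eq_degree, Finset.card_eq_sum_ones]
  rcases x with i | i | i
  · rw [sum_neighborFinset_core hr]; rfl
  · rw [sum_neighborFinset_apex hr]; rfl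
  · rw [sum_neighborFinset_tip]; rfl

/-- Rotations are transitive on each kind of vertices, and automorphisms preserve degrees. -/
theorem mem_orbit_iff_deg_eq (hr : 3 ≤ r) (x y : DiamondVertex r) :
    y ∈ MulAction.orbit (cycleDiamondGraph r ≃g cycleDiamondGraph r) x ↔ y.deg = x.deg := by
  constructor
  · rintro ⟨g, rfl⟩
    rw [← degree_eq_deg hr, ← degree_eq_deg hr]
    exact SimpleGraph.Iso.degree_eq g x
  · intro h
    obtain ⟨j, rfl⟩ := exists_shift_eq h
    exact ⟨shiftIso j, rfl⟩
end

/-- The matrix `P + P⁻¹` with `P` the rotation by one step. -/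
def rotationSum (r : ℕ) (R : Type*) [Semiring R] : Matrix (DiamondVertex r) (DiamondVertex r) R :=
  Matrix.of fun x y => (if shift 1 x = y then 1 else 0) + (if shift (-1) x = y then 1 else 0)

section
variable {r : ℕ} [NeZero r]

theorem rotationSum_mulVec (v : DiamondVertex r → ℝ) (x : DiamondVertex r) :
    (rotationSum r ℝ).mulVec v x = v (shift 1 x) + v (shift (-1) x) := by
  simp [rotationSum, Matrix.mulVec, dotProduct, add_mul, Finset.sum_add_distrib]

/-- Compare the two sides at a coordinate of maximal absolute value. -/
theorem abs_le_two_of_rotationSum_mulVec {s : ℝ} {v : DiamondVertex r → ℝ} (hv : v ≠ 0)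
    (h : (rotationSum r ℝ).mulVec v = s • v) : |s| ≤ 2 := by
  obtain ⟨y, hy⟩ := Function.ne_iff.1 hv
  have : Nonempty (DiamondVertex r) := ⟨y⟩
  obtain ⟨x, hx⟩ := Finite.exists_max fun x => |v x|
  have hpos : 0 < |v x| := (abs_pos.2 hy).trans_le (hx y)
  have h1 := congrFun h x
  rw [rotationSum_mulVec, Pi.smul_apply, smul_eq_mul] at h1
  have h2 : |s| * |v x| ≤ 2 * |v x| := by
    rw [← abs_mul, ← h1, two_mul]
    exact (abs_add_le _ _).trans (add_le_add (hx _) (hx _))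
  exact le_of_mul_le_mul_right h2 hpos

theorem isAlgebraic_of_rotationSum_mulVec {s : ℝ} {v : DiamondVertex r → ℝ} (hv : v ≠ 0)
    (h : (rotationSum r ℝ).mulVec v = s • v) : IsAlgebraic ℚ s := by
  refine isAlgebraic_of_mulVec_eq_smul (rotationSum r ℚ) hv ?_
  rw [← h]
  congr 1
  ext x y
  simp only [rotationSum, Matrix.map_apply, Matrix.of_apply, map_add]
  split_ifs <;> simp

theorem rotationSum_commute_diagIndicator {K : Finset (DiamondVertex r)} {v : DiamondVertex r}
    (hK : ∀ x, x ∈ K ↔ x.deg = v.deg) : Commute (rotationSum r ℝ) (diagIndicator K) := by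
  ext x y
  rw [mul_diagIndicator_apply, diagIndicator_mul_apply]
  by_cases h : x.deg = y.deg
  · simp only [hK, h]
  · have h1 : ∀ j, shift j x ≠ y := by
      rintro j rfl
      simp at h
    simp [rotationSum, h1]

/-- Elimination for the eigenvalue equations at the three kinds of vertices. They form a `3 × 3`
linear system with coefficients in the commutative ring generated by the rotation `P` and `P⁻¹`;
applying its adjugate shows that the determinant, which is linear in `P + P⁻¹`, annihilates `v`. -/
theorem smul_rotationSum_mulVec (x y z : ℝ) (v : DiamondVertex r → ℝ)
    (h1 : ∀ i, x * v (core i) = v (core (i + 1)) + (v (core (i - 1)) +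
      (v (apex i) + (v (apex (i - 1)) + v (tip i)))))
    (h2 : ∀ i, y * v (apex i) = v (core i) + (v (core (i + 1)) + v (tip i)))
    (h3 : ∀ i, z * v (tip i) = v (core i) + v (apex i)) :
    (z * (y + 1)) • (rotationSum r ℝ).mulVec v = (x * y * z - x - y - 2 * z - 2) • v := by
  ext w
  rw [Pi.smul_apply, Pi.smul_apply, rotationSum_mulVec, smul_eq_mul, smul_eq_mul]
  have e1 : ∀ i : ZMod r, i - 1 + 1 = i := fun i => by ring
  have e2 : ∀ i : ZMod r, i + 1 - 1 = i := fun i => by ring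
  -- The coefficients below are the rows of the adjugate matrix.
  rcases w with i | i | i <;> simp only [shift, ← sub_eq_add_neg]
  · have a1 := h1 i
    have a2 := h2 i
    have a2' := h2 (i - 1)
    have a3 := h3 i
    have a3' := h3 (i - 1)
    rw [e1] at a2'
    linear_combination (-(y * z - 1)) * a1 - (z + 1) * a2 - z * a2' - (1 + y) * a3 - a3'
  · have a1 := h1 i
    have a1' := h1 (i + 1)
    have a2 := h2 i
    have a2p := h2 (i + 1)
    have a2m := h2 (i - 1)
    have a3 := h3 i
    have a3p := h3 (i + 1)
    have a3m := h3 (i - 1)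
    rw [e1] at a2m
    rw [e2] at a1'
    linear_combination (-(z + 1)) * a1 - z * a1' - (x * z - 1) * a2 + z * (a2p + a2m) - (x + 1) * a3
      - a3p + (a3p + a3m)
  · have a1 := h1 i
    have a1' := h1 (i + 1)
    have a2 := h2 i
    have a2p := h2 (i + 1)
    have a2m := h2 (i - 1)
    have a3 := h3 i
    have a3p := h3 (i + 1)
    have a3m := h3 (i - 1)
    rw [e1] at a2m
    rw [e2] at a1'
    linear_combination (-(y + 1)) * a1 - a1' - (x + 1) * a2 - a2m + (a2p + a2m)
      - (x * y - 2) * a3 + y * (a3p + a3m) + (a3p + a3m)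
end

/-! ### The perturbed adjacency matrix -/

theorem isHermitian_adjMatrix_add_smul_diagIndicator {X : Type*} [DecidableEq X]
    (G : SimpleGraph X) [DecidableRel G.Adj] (K : Finset X) (Q : ℝ) :
    (G.adjMatrix ℝ + Q • diagIndicator K).IsHermitian := by
  rw [Matrix.IsHermitian, Matrix.conjTranspose_eq_transpose_of_trivial, Matrix.transpose_add,
    SimpleGraph.transpose_adjMatrix, Matrix.transpose_smul, diagIndicator,
    Matrix.diagonal_transpose]

theorem exists_rotationSum_eigenvalue {r : ℕ} [NeZero r] {v : DiamondVertex r → ℝ} (hv : v ≠ 0) {D N : ℝ}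
    (h : D • (rotationSum r ℝ).mulVec v = N • v) (hDN : D = 0 → N ≠ 0) :
    ∃ s, (rotationSum r ℝ).mulVec v = s • v ∧ D * s = N := by
  have hD : D ≠ 0 := by
    intro hD
    rw [hD, zero_smul] at h
    exact (smul_ne_zero (hDN hD) hv) h.symm
  refine ⟨N / D, ?_, mul_div_cancel₀ N hD⟩
  rw [div_eq_inv_mul, mul_smul, ← h, smul_smul, inv_mul_cancel₀ hD, one_smul]

theorem quadratic_ne_zero_of_transcendental {Q : ℝ} (hQ : Transcendental ℚ Q) {a b c : ℚ}
    (habc : a ≠ 0 ∨ b ≠ 0 ∨ c ≠ 0) : (a : ℝ) * Q ^ 2 + b * Q + c ≠ 0 := by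
  intro h0
  refine hQ ⟨Polynomial.C a * Polynomial.X ^ 2 + Polynomial.C b * Polynomial.X + Polynomial.C c,
    fun h1 => ?_, by simpa using h0⟩
  have h2 := fun n => congrArg (Polynomial.coeff · n) h1
  have c0 := h2 0
  have c1 := h2 1
  have c2 := h2 2
  simp [Polynomial.coeff_X, Polynomial.coeff_C] at c0 c1 c2
  tauto

section
variable {r : ℕ} [NeZero r] [DecidableRel (cycleDiamondGraph r).Adj]

/-- The three parameters `p`, `q`, `t` are the diagonal entries of `Q D_K` at the vertices `core i`,
`apex i` and `tip i`. -/
theorem smul_rotationSum_mulVec_of_eigenvector (hr : 3 ≤ r) {K : Finset (DiamondVertex r)}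
    {Q l : ℝ} {v : DiamondVertex r → ℝ} {p q t : ℝ}
    (hp : ∀ i, (if core i ∈ K then Q else 0) = p) (hq : ∀ i, (if apex i ∈ K then Q else 0) = q)
    (ht : ∀ i, (if tip i ∈ K then Q else 0) = t)
    (h : ((cycleDiamondGraph r).adjMatrix ℝ + Q • diagIndicator K).mulVec v = l • v) :
    ((l - t) * (l - q + 1)) • (rotationSum r ℝ).mulVec v =
      ((l - p) * (l - q) * (l - t) - (l - p) - (l - q) - 2 * (l - t) - 2) • v := by
  have key : ∀ x, (l - if x ∈ K then Q else 0) * v x =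
      ∑ y ∈ (cycleDiamondGraph r).neighborFinset x, v y := by
    intro x
    have h1 := congrFun h x
    rw [Matrix.add_mulVec, Pi.add_apply, SimpleGraph.adjMatrix_mulVec_apply, Matrix.smul_mulVec,
      Pi.smul_apply, Pi.smul_apply, diagIndicator, Matrix.mulVec_diagonal] at h1
    simp only [smul_eq_mul] at h1
    split_ifs at h1 ⊢ <;> linear_combination -h1
  refine smul_rotationSum_mulVec _ _ _ v (fun i => ?_) (fun i => ?_) (fun i => ?_)
  · rw [← sum_neighborFinset_core hr, ← key, hp]
  · rw [← sum_neighborFinset_apex hr, ← key, hq]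
  · rw [← sum_neighborFinset_tip, ← key, ht]

/-- An eigenvector of `M + Q D_K` is an eigenvector of the rotation sum for an algebraic number `s`
with `|s| ≤ 2`, and its eigenvalue `l` satisfies `φ(l) = Q ψ(l)`. Here `φ` and `ψ` are the
characteristic polynomials of the `3 × 3` matrix by which `M` acts on the `s`-part and of its
principal submatrix with the row and column of `K` removed; the nonvanishing resultant says that
they are coprime. -/
theorem exists_rotationSum_eigenvalue_and_cubic (hr : 3 ≤ r) {K : Finset (DiamondVertex r)}
    {w : DiamondVertex r} (hK : ∀ x, x ∈ K ↔ x.deg = w.deg) {Q : ℝ} (hQ : Transcendental ℚ Q)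
    {l : ℝ} {v : DiamondVertex r → ℝ} (hv : v ≠ 0)
    (h : ((cycleDiamondGraph r).adjMatrix ℝ + Q • diagIndicator K).mulVec v = l • v) :
    ∃ s b c : ℝ, |s| ≤ 2 ∧ (rotationSum r ℝ).mulVec v = s • v ∧
      IsAlgebraic ℚ s ∧ IsAlgebraic ℚ b ∧ IsAlgebraic ℚ c ∧
      (c * (b - s) - 2) ^ 2 + b * (c + b * (b - s) - 4 - s) * (c * (b - s) - 2) -
        c * (c + b * (b - s) - 4 - s) ^ 2 ≠ 0 ∧
      l ^ 3 - s * l ^ 2 - (4 + s) * l - 2 = Q * (l ^ 2 - b * l - c) := by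
  have hroot := fun a b c habc => quadratic_ne_zero_of_transcendental hQ (a := a) (b := b) (c := c) habc
  have h0 : IsAlgebraic ℚ (0 : ℝ) := isAlgebraic_zero
  have h1 : IsAlgebraic ℚ (1 : ℝ) := isAlgebraic_one
  have h2 : IsAlgebraic ℚ (2 : ℝ) := by
    simpa using isAlgebraic_algebraMap (R := ℚ) (A := ℝ) 2
  -- In each case the coefficient of the rotation sum and the right-hand side cannot vanish together,
  -- as this would make `Q` a root of a nonzero polynomial of degree at most two.
  rcases w with i | i | i <;> simp only [deg] at hK
  · have hE := smul_rotationSum_mulVec_of_eigenvector hr (p := Q) (q := 0) (t := 0)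
      (by simp [hK]) (by simp [hK]) (by simp [hK]) h
    obtain ⟨s, hs, hsl⟩ := exists_rotationSum_eigenvalue hv hE (by
      intro hD hN
      rcases mul_eq_zero.1 hD with hl | hl
      · have hl0 : l = 0 := by linarith
        subst hl0
        exact hroot 0 1 (-2) (by simp) (by push_cast; linear_combination hN)
      · have hl1 : l = -1 := by linarith
        subst hl1
        norm_num at hN)
    have hs2 := abs_le.1 (abs_le_two_of_rotationSum_mulVec hv hs)
    refine ⟨s, 0, 1, abs_le.2 hs2, hs, isAlgebraic_of_rotationSum_mulVec hv hs, h0, h1,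
      fun e => ?_, by linear_combination -hsl⟩
    have : 2 * s + 5 = 0 := by linear_combination -e
    linarith [hs2.1]
  · have hE := smul_rotationSum_mulVec_of_eigenvector hr (p := 0) (q := Q) (t := 0)
      (by simp [hK]) (by simp [hK]) (by simp [hK]) h
    obtain ⟨s, hs, hsl⟩ := exists_rotationSum_eigenvalue hv hE (by
      intro hD hN
      rcases mul_eq_zero.1 hD with hl | hl
      · have hl0 : l = 0 := by linarith
        subst hl0
        exact hroot 0 1 (-2) (by simp) (by push_cast; linear_combination hN)
      · have hl1 : l = Q - 1 := by linarith
        subst hl1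
        exact hroot (-1) (-1) 1 (by simp) (by push_cast; linear_combination hN))
    have hs2 := abs_le.1 (abs_le_two_of_rotationSum_mulVec hv hs)
    have hsa := isAlgebraic_of_rotationSum_mulVec hv hs
    refine ⟨s, s, 1, abs_le.2 hs2, hs, hsa, hsa, h1,
      fun e => ?_, by linear_combination -hsl⟩
    have : s ^ 2 = 5 := by linear_combination e
    nlinarith [hs2.1, hs2.2]
  · have hE := smul_rotationSum_mulVec_of_eigenvector hr (p := 0) (q := 0) (t := Q)
      (by simp [hK]) (by simp [hK]) (by simp [hK]) h
    obtain ⟨s, hs, hsl⟩ := exists_rotationSum_eigenvalue hv hE (by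
      intro hD hN
      rcases mul_eq_zero.1 hD with hl | hl
      · have hl0 : l = Q := by linarith
        subst hl0
        exact hroot 0 (-2) (-2) (by simp) (by push_cast; linear_combination hN)
      · have hl1 : l = -1 := by linarith
        subst hl1
        exact hroot 0 1 1 (by simp) (by push_cast; linear_combination hN))
    have hs2 := abs_le.1 (abs_le_two_of_rotationSum_mulVec hv hs)
    have hsa := isAlgebraic_of_rotationSum_mulVec hv hs
    refine ⟨s, s, 2 + s, abs_le.2 hs2, hs, hsa, hsa, h2.add hsa,
      fun e => ?_, by linear_combination -hsl⟩
    have : (4 : ℝ) = 0 := by linear_combination -e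
    norm_num at this
end

theorem mainTheorem8 (r : ℕ) [NeZero r] (hr : 3 ≤ r)
    [DecidableRel (cycleDiamondGraph r).Adj]
    (K : Finset (DiamondVertex r))
    (hK : ∃ v : DiamondVertex r, (K : Set (DiamondVertex r)) =
      MulAction.orbit (cycleDiamondGraph r ≃g cycleDiamondGraph r) v)
    (Q : ℝ) (hQ : Transcendental ℚ Q) :
    ExhibitsPGFR ((cycleDiamondGraph r).adjMatrix ℝ + Q • diagIndicator K) K := by
  obtain ⟨w, hw⟩ := hK
  have hKdeg : ∀ x, x ∈ K ↔ x.deg = w.deg := fun x => by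
    rw [← Finset.mem_coe, hw, mem_orbit_iff_deg_eq hr]
  obtain ⟨f, hf⟩ := exists_addHom_eq_add_of_cubic hQ
  have key : ∀ (l : ℝ) (v : DiamondVertex r → ℝ), v ≠ 0 →
      ((cycleDiamondGraph r).adjMatrix ℝ + Q • diagIndicator K).mulVec v = l • v →
      ∃ s, |s| ≤ 2 ∧ (rotationSum r ℝ).mulVec v = s • v ∧ f l = s + Q := by
    intro l v hv h
    obtain ⟨s, b, c, hs2, hs, hsa, hb, hc, hres, hl⟩ :=
      exists_rotationSum_eigenvalue_and_cubic hr hKdeg hQ hv h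
    exact ⟨s, hs2, hs, hf s b c l hsa hb hc hres hl⟩
  have hshift : w ≠ shift 1 w := fun h =>
    zmod_one_ne_zero hr (shift_eq_self_iff.1 h.symm)
  refine exhibitsPGFR_of_eigenvectors (S := rotationSum r ℝ + Q • 1) (x := w) (y := shift 1 w)
    (isHermitian_adjMatrix_add_smul_diagIndicator _ K Q) f ?_ ?_ ?_ ?_ hshift ?_
  · intro l v hv h
    obtain ⟨s, -, hs, hfs⟩ := key l v hv h
    rw [Matrix.add_mulVec, Matrix.smul_mulVec, Matrix.one_mulVec, hs, hfs, add_smul]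
  · intro l l' v v' hv hv' h h'
    obtain ⟨s, hs, -, hfs⟩ := key l v hv h
    obtain ⟨s', hs', -, hfs'⟩ := key l' v' hv' h'
    rw [hfs, hfs', add_sub_add_right_eq_sub]
    have := abs_sub s s'
    -- `|s - s'| ≤ 4 < 2π`
    have := Real.pi_gt_three
    linarith
  · exact (rotationSum_commute_diagIndicator hKdeg).add_left ((Commute.one_left _).smul_left Q)
  · exact (hKdeg w).2 rfl
  · simp only [rotationSum, Matrix.add_apply, Matrix.of_apply, Matrix.smul_apply,
      Matrix.one_apply_ne hshift, smul_zero, add_zero, if_true]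
    split_ifs <;> norm_num
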